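/- Let $N, L$ be positive integers and $[L]=\{0,1,\dots,L-1\}$. For $\kappa\in[L]$ put $\eta(\kappa)=e^{\pi i(2\kappa+1)/L}$ if $N$ is even and $\eta(\kappa)=e^{2\pi i\kappa/L}$ if $N$ is odd; these are the solutions of $\eta^L=(-1)^{N-1}$. For $\Delta\in\mathbb{R}$, the Bethe equations for $\boldsymbol\xi=(\xi_1,\dots,\xi_N)\in\mathbb{C}^N$ are $$\xi_i^L=(-1)^{N-1}\prod_{j\ne i}\frac{1+\xi_i\xi_j-2\Delta\xi_i}{1+\xi_i\xi_j-2\Delta\xi_j},\qquad i=1,\dots,N,$$ where a solution is required to have $1+\xi_i\xi_j-2\Delta\xi_j\neq0$ for all $i\neq j$ (a factor with $j=i$ would be identically $1$). Put $$F_i(\boldsymbol\xi)=\xi_i^L+(-1)^N\prod_{j\ne i}\frac{1+\xi_i\xi_j-2\Delta\xi_i}{1+\xi_i\xi_j-2\Delta\xi_j},\qquad J_i=\Big(\frac{\partial F_i}{\partial\xi_1},\dots,\frac{\partial F_i}{\partial\xi_N}\Big),$$ let $\Vert\cdot\Vert$ be the Hermitian norm on $\mathbb{C}^N$, and let $\overline{J_i}$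 be the entrywise complex conjugate of $J_i$. Given $k=(k_1,\dots,k_N)\in[L]^N$, the Newton–Kaczmarz sequence $\boldsymbol\xi(n)\in\mathbb{C}^N$, $n=0,1,2,\dots$, is defined by $\boldsymbol\xi(0)=(\eta(k_1),\dots,\eta(k_N))$ and $$\boldsymbol\xi(n,0)=\boldsymbol\xi(n),\qquad \boldsymbol\xi(n,i+1)=\boldsymbol\xi(n,i)-\frac{F_{i+1}(\boldsymbol\xi(n,i))}{\Vert J_{i+1}(\boldsymbol\xi(n,i))\Vert^2}\,\overline{J_{i+1}(\boldsymbol\xi(n,i))}\quad(0\le i\le N-1),\qquad \boldsymbol\xi(n+1)=\boldsymbol\xi(n,N).$$ Let $k\in[L]^N$ have pairwise distinct entries, and suppose that $1+\eta(k_i)\eta(k_j)\neq0$ for all $i\neq j$. Then there is an $\epsilon>0$ such that for every $\Delta\in\mathbb{R}$ with $|\Delta|<\epsilon$ the following holds. The sequence is well defined: for all $n\ge0$ and $0\le i\le N-1$, at the point $\boldsymbol\xi=\boldsymbol\xi(n,i)$ one has $1+\xi_a\xi_b-2\Delta\xi_b\ne0$ for all $a\ne b$, and $J_{i+1}(\boldsymbol\xi(n,i))\neq0$.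 Moreover, $\boldsymbol\xi(n)$ converges as $n\to\infty$, and its limit has pairwise distinct entries and solves the Bethe equations. -/

import Mathlib

open Filter Topology

noncomputable section

namespace XXZ

/-- The solutions of `η ^ L = (-1) ^ (N - 1)`, indexed by `k ∈ {0, …, L - 1}`. -/
def rootEta (N L : ℕ) (k : Fin L) : ℂ :=
  if Even N then
    Complex.exp (Real.pi * Complex.I * (2 * ((k : ℕ) : ℂ) + 1) / (L : ℂ))
  else
    Complex.exp (2 * Real.pi * Complex.I * ((k : ℕ) : ℂ) / (L : ℂ))

variable {N : ℕ}

/-- The base point `η(k) = (η(k₁), …, η(k_N))` for `k ∈ {0, …, L - 1} ^ N`. -/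
def basePoint (L : ℕ) (k : Fin N → Fin L) : Fin N → ℂ :=
  fun i => rootEta N L (k i)

/-- The quantity `1 + ξᵢ ξⱼ - 2 Δ ξⱼ`, the `j`-th denominator in the `i`-th Bethe equation; the
corresponding numerator `1 + ξᵢ ξⱼ - 2 Δ ξᵢ` is the one with `i` and `j` exchanged. -/
def betheDen (Δ : ℝ) (ξ : Fin N → ℂ) (i j : Fin N) : ℂ :=
  1 + ξ i * ξ j - 2 * (Δ : ℂ) * ξ j

/-- The product over `j` of `(1 + ξᵢ ξⱼ - 2 Δ ξᵢ) / (1 + ξᵢ ξⱼ - 2 Δ ξⱼ)`. The factor with `j = i`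
has equal numerator and denominator; it is the constant rational function `1` and is left out. -/
def betheProd (Δ : ℝ) (i : Fin N) (ξ : Fin N → ℂ) : ℂ :=
  ∏ j ∈ Finset.univ.erase i,
    (1 + ξ i * ξ j - 2 * (Δ : ℂ) * ξ i) / (1 + ξ i * ξ j - 2 * (Δ : ℂ) * ξ j)

/-- Keeping the factor `j = i` makes no difference where its denominator does not vanish. -/
theorem betheProd_eq_prod_univ (Δ : ℝ) (i : Fin N) (ξ : Fin N → ℂ)
    (h : betheDen Δ ξ i i ≠ 0) :
    betheProd Δ i ξ =
      ∏ j, (1 + ξ i * ξ j - 2 * (Δ : ℂ) * ξ i) / (1 + ξ i * ξ j - 2 * (Δ : ℂ) * ξ j) := by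
  unfold betheDen at h
  rw [← Finset.mul_prod_erase Finset.univ _ (Finset.mem_univ i), div_self h, one_mul, betheProd]

/-- All Bethe equations are defined at `ξ`: no denominator (and, by the symmetry between `i` and
`j`, no numerator) vanishes. -/
def BetheDefined (Δ : ℝ) (ξ : Fin N → ℂ) : Prop :=
  ∀ i j, i ≠ j → betheDen Δ ξ i j ≠ 0

/-- `ξ` solves the Bethe equations
`ξᵢ ^ L = (-1) ^ (N - 1) ∏ⱼ (1 + ξᵢ ξⱼ - 2 Δ ξᵢ) / (1 + ξᵢ ξⱼ - 2 Δ ξⱼ)`, none of whose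
denominators vanishes. -/
def IsBetheSolution (L : ℕ) (Δ : ℝ) (ξ : Fin N → ℂ) : Prop :=
  BetheDefined Δ ξ ∧ ∀ i, ξ i ^ L = (-1) ^ (N - 1) * betheProd Δ i ξ

/-- The function `Fᵢ` whose vanishing is the `i`-th Bethe equation. -/
def betheF (L : ℕ) (Δ : ℝ) (i : Fin N) (ξ : Fin N → ℂ) : ℂ :=
  ξ i ^ L + (-1) ^ N * betheProd Δ i ξ

/-- `Jᵢ = (∂Fᵢ/∂ξ₁, …, ∂Fᵢ/∂ξ_N)`, the vector of complex partial derivatives. -/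
def betheJ (L : ℕ) (Δ : ℝ) (i : Fin N) (ξ : Fin N → ℂ) : Fin N → ℂ :=
  fun j => fderiv ℂ (betheF L Δ i) ξ (Pi.single j 1)

/-- One Newton-Kaczmarz step for the `i`-th equation,
`ξ - (Fᵢ(ξ) / ‖Jᵢ(ξ)‖²) conj Jᵢ(ξ)`, with the Hermitian norm of `ℂ ^ N`: the orthogonal projection
of `ξ` onto the hyperplane `Fᵢ(ξ) + ∑ⱼ ∂Fᵢ/∂ξⱼ(ξ) (zⱼ - ξⱼ) = 0`. -/
def kaczmarzStep (L : ℕ) (Δ : ℝ) (i : Fin N) (ξ : Fin N → ℂ) : Fin N → ℂ :=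
  fun j => ξ j -
    betheF L Δ i ξ / ((∑ m, ‖betheJ L Δ i ξ m‖ ^ 2 : ℝ) : ℂ) *
      (starRingEnd ℂ) (betheJ L Δ i ξ j)

/-- The intermediate points of one sweep through the equations: `sweep L Δ ξ 0 = ξ`, and
`sweep L Δ ξ (i + 1)` is obtained from `sweep L Δ ξ i` by the step for the equation with
(zero-based) index `i`. Only the indices `0, …, N` are used. -/
def sweep (L : ℕ) (Δ : ℝ) (ξ : Fin N → ℂ) : ℕ → (Fin N → ℂ)
  | 0 => ξ
  | i + 1 =>
      if h : i < N then kaczmarzStep L Δ ⟨i, h⟩ (sweep L Δ ξ i) else sweep L Δ ξ i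

/-- The Newton-Kaczmarz sequence `ξ(n)` with base point `ξ(0) = η(k)`. -/
def kaczmarzSeq (L : ℕ) (Δ : ℝ) (k : Fin N → Fin L) : ℕ → (Fin N → ℂ)
  | 0 => basePoint L k
  | n + 1 => sweep L Δ (kaczmarzSeq L Δ k n) N

end XXZ

end

/-! At `Δ = 0` the Bethe equations decouple, and the gradient of the `i`-th one at the base point is
a nonzero multiple of the `i`-th basis vector. At a zero of `Fᵢ`, the derivative of a Kaczmarz step
with respect to `ξ` is the orthogonal projection onto the kernel of the gradient of `Fᵢ`. A sweep at
`Δ = 0` therefore kills the coordinates of a tangent vector one after the other: its derivative at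
the base point is zero. Hence, for small `Δ`, the sweep contracts a fixed ball about the base point,
and its iterates converge to a fixed point. The displacement over a sweep is a linear combination of
the conjugate gradients met along it, with coefficients `-Fᵢ / ‖Jᵢ‖²`. As these gradients stay
linearly independent near the base point, every `Fᵢ` vanishes at the fixed point. -/

open scoped NNReal

section ParametrizedIteration

theorem exists_tendsto_iterate_of_lipschitzOnWith_closedBall {X : Type*} [MetricSpace X]
    [CompleteSpace X] {f : X → X} {K : ℝ≥0} {p : X} {r : ℝ} (hK : K < 1)
    (hf : LipschitzOnWith K f (Metric.closedBall p r)) (hp : dist (f p) p ≤ (1 - K) * r) :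
    (∀ n, f^[n] p ∈ Metric.closedBall p r) ∧
      ∃ ξ ∈ Metric.closedBall p r,
        Function.IsFixedPt f ξ ∧ Tendsto (fun n => f^[n] p) atTop (𝓝 ξ) := by
  have hK' : 0 < 1 - (K : ℝ) := sub_pos.2 (mod_cast hK)
  have hr : 0 ≤ r := nonneg_of_mul_nonneg_right (dist_nonneg.trans hp) hK'
  have hpr : p ∈ Metric.closedBall p r := Metric.mem_closedBall_self hr
  have hmaps : Set.MapsTo f (Metric.closedBall p r) (Metric.closedBall p r) := fun x hx =>
    calc dist (f x) p ≤ dist (f x) (f p) + dist (f p) p := dist_triangle _ _ _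
      _ ≤ K * r + (1 - K) * r := by
        gcongr
        exact (hf.dist_le_mul x hx p hpr).trans (by gcongr; exact hx)
      _ = r := by ring
  have hcontr : ContractingWith K (hmaps.restrict f _ _) := ⟨hK, hf.mapsToRestrict hmaps⟩
  obtain ⟨ξ, hξ, hfix, hlim, -⟩ := hcontr.exists_fixedPoint'
    Metric.isClosed_closedBall.isComplete hmaps hpr (edist_ne_top _ _)
  exact ⟨fun n => hmaps.iterate n hpr, ξ, hξ, hfix, hlim⟩

variable {𝕜 V E : Type*} [NontriviallyNormedField 𝕜] [NormedAddCommGroup V] [NormedSpace 𝕜 V]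
  [NormedAddCommGroup E] [NormedSpace 𝕜 E] {G : V × E → E} {D : V × E →L[𝕜] E} {t₀ : V} {p : E}

theorem exists_nhds_lipschitzOnWith_slice {K : ℝ≥0} (hG : HasStrictFDerivAt G D (t₀, p))
    (hK : ‖D.comp (.inr 𝕜 V E)‖₊ < K) :
    ∃ s ∈ 𝓝 (t₀, p), ∀ t, LipschitzOnWith K (fun x => G (t, x)) {x | (t, x) ∈ s} := by
  obtain ⟨s, hs, hGs⟩ := hG.approximates_deriv_on_nhds (.inr (tsub_pos_of_lt hK))
  refine ⟨s, hs, fun t => ?_⟩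
  have hslice : ApproximatesLinearOn (fun x => G (t, x)) (D.comp (.inr 𝕜 V E))
      {x | (t, x) ∈ s} (K - ‖D.comp (.inr 𝕜 V E)‖₊) := fun x hx y hy => by
    simpa using hGs (t, x) hx (t, y) hy
  simpa only [add_tsub_cancel_of_le hK.le] using lipschitzOnWith_iff_restrict.2 hslice.lipschitz

theorem eventually_tendsto_iterate_of_hasStrictFDerivAt [CompleteSpace E]
    (hG : HasStrictFDerivAt G D (t₀, p)) (hD : ‖D.comp (.inr 𝕜 V E)‖₊ < 1)
    (hp : G (t₀, p) = p) {P : V × E → Prop} (hP : ∀ᶠ x in 𝓝 (t₀, p), P x) :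
    ∀ᶠ t in 𝓝 t₀, (∀ n, P (t, (fun x => G (t, x))^[n] p)) ∧
      ∃ ξ, P (t, ξ) ∧ G (t, ξ) = ξ ∧ Tendsto (fun n => (fun x => G (t, x))^[n] p) atTop (𝓝 ξ) := by
  obtain ⟨K, hDK, hK⟩ := exists_between hD
  obtain ⟨s, hs, hLip⟩ := exists_nhds_lipschitzOnWith_slice hG hDK
  obtain ⟨U, hU, W, hW, hUW⟩ :=
    eventually_prod_iff.1 (nhds_prod_eq (x := t₀) (y := p) ▸ (eventually_mem_set.2 hs).and hP)
  obtain ⟨r, hr, hrW⟩ := Metric.nhds_basis_closedBall.mem_iff.1 hW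
  have hcont : Tendsto (fun t => G (t, p)) (𝓝 t₀) (𝓝 p) := by
    have h := hG.continuousAt.comp (f := fun t => (t, p))
      (Continuous.prodMk_left p).continuousAt
    rwa [ContinuousAt, Function.comp_apply, hp] at h
  have hK' : 0 < (1 - (K : ℝ)) * r := mul_pos (sub_pos.2 (mod_cast hK)) hr
  filter_upwards [hU, hcont (Metric.closedBall_mem_nhds p hK')] with t hUt hpt
  obtain ⟨hmem, ξ, hξ, hfix, hlim⟩ := exists_tendsto_iterate_of_lipschitzOnWith_closedBall hK
    ((hLip t).mono fun x hx => (hUW hUt (hrW hx)).1) hpt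
  exact ⟨fun n => (hUW hUt (hrW (hmem n))).2, ξ, (hUW hUt (hrW hξ)).2, hfix, hlim⟩

end ParametrizedIteration

theorem eventually_forall_apply_ne {ι X : Type*} [Finite ι] [TopologicalSpace X] [T2Space X]
    (p : ι → X) : ∀ᶠ ξ in 𝓝 p, ∀ i j, p i ≠ p j → ξ i ≠ ξ j := by
  simp only [eventually_all]
  exact fun i j hij =>
    (isOpen_ne_fun (continuous_apply i) (continuous_apply j)).mem_nhds hij

section KaczmarzCorrection

variable {ι : Type*} [Fintype ι]

theorem ofReal_sum_norm_sq_ne_zero {w : ι → ℂ} (hw : w ≠ 0) :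
    ((∑ m, ‖w m‖ ^ 2 : ℝ) : ℂ) ≠ 0 := by
  obtain ⟨i, hi⟩ := Function.ne_iff.1 hw
  have hpos : 0 < ∑ m, ‖w m‖ ^ 2 :=
    Finset.sum_pos' (fun _ _ => by positivity) ⟨i, Finset.mem_univ i, by positivity⟩
  exact_mod_cast hpos.ne'

-- The derivative of `J` does not enter, because its coefficient contains the factor `f x = 0`.
theorem hasStrictFDerivAt_kaczmarz_correction {X : Type*} [NormedAddCommGroup X]
    [NormedSpace ℝ X] {f : X → ℂ} {f' : X →L[ℝ] ℂ} {J : X → ι → ℂ} {x : X}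
    (hf : HasStrictFDerivAt f f' x) (hJ : ContDiffAt ℝ 1 J x) (hfx : f x = 0) (hJx : J x ≠ 0) :
    HasStrictFDerivAt (fun y => (f y / ((∑ m, ‖J y m‖ ^ 2 : ℝ) : ℂ)) • star (J y))
      (f'.smulRight (((∑ m, ‖J x m‖ ^ 2 : ℝ) : ℂ)⁻¹ • star (J x))) x := by
  have hsum : ContDiffAt ℝ 1 (fun y => ((∑ m, ‖J y m‖ ^ 2 : ℝ) : ℂ)) x :=
    Complex.ofRealCLM.contDiff.contDiffAt.comp x
      (ContDiffAt.sum fun m _ => (contDiffAt_pi.1 hJ m).norm_sq ℝ)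
  have hstar : ContDiffAt ℝ 1 (fun y => star (J y)) x :=
    contDiffAt_pi.2 fun m => Complex.conjCLE.contDiff.contDiffAt.comp x (contDiffAt_pi.1 hJ m)
  have hdir := ((hsum.inv (ofReal_sum_norm_sq_ne_zero hJx)).smul hstar).hasStrictFDerivAt
    one_ne_zero
  have h := hf.smul hdir
  rw [hfx, zero_smul, zero_add] at h
  refine h.congr_of_eventuallyEq (.of_forall fun y => ?_)
  simp only [Pi.smul_apply', Pi.inv_apply, smul_smul, div_eq_mul_inv]

end KaczmarzCorrection

namespace XXZ

section RootEta

variable {N L : ℕ}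

theorem rootEta_eq_mul_pow (k : Fin L) :
    rootEta N L k =
      rootEta N L ⟨0, k.pos⟩ * Complex.exp (2 * Real.pi * Complex.I / L) ^ (k : ℕ) := by
  unfold rootEta
  split_ifs
  all_goals
    rw [← Complex.exp_nat_mul, ← Complex.exp_add]
    congr 1
    push_cast
    ring

theorem rootEta_ne_zero (k : Fin L) : rootEta N L k ≠ 0 := by
  unfold rootEta
  split_ifs <;> exact Complex.exp_ne_zero _

theorem rootEta_zero_pow_add_eq_zero (hL : 0 < L) : rootEta N L ⟨0, hL⟩ ^ L + (-1) ^ N = 0 := by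
  have hL' : (L : ℂ) ≠ 0 := Nat.cast_ne_zero.2 hL.ne'
  rcases N.even_or_odd with hN | hN
  · have h : (L : ℂ) * (Real.pi * Complex.I / L) = Real.pi * Complex.I := by field_simp
    simp [rootEta, hN, hN.neg_one_pow, ← Complex.exp_nat_mul, h]
  · simp [rootEta, Nat.not_even_iff_odd.2 hN, hN.neg_one_pow]

theorem rootEta_pow_add_eq_zero (k : Fin L) : rootEta N L k ^ L + (-1) ^ N = 0 := by
  rw [rootEta_eq_mul_pow, mul_pow, pow_right_comm,
    (Complex.isPrimitiveRoot_exp L k.pos.ne').pow_eq_one, one_pow, mul_one,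
    rootEta_zero_pow_add_eq_zero]

theorem rootEta_injective : Function.Injective (rootEta N L) := fun a b hab => by
  rw [rootEta_eq_mul_pow a, rootEta_eq_mul_pow b] at hab
  exact Fin.ext ((Complex.isPrimitiveRoot_exp L a.pos.ne').pow_inj a.2 b.2
    (mul_left_cancel₀ (rootEta_ne_zero _) hab))

end RootEta

variable {N L : ℕ} {Δ : ℝ} {ξ p : Fin N → ℂ}

section Differentiability

theorem BetheDefined.eventually (h : BetheDefined Δ ξ) :
    ∀ᶠ x : ℝ × (Fin N → ℂ) in 𝓝 (Δ, ξ), BetheDefined x.1 x.2 := by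
  simp only [BetheDefined, eventually_all]
  intro i j hij
  have hcont : ContinuousAt (fun x : ℝ × (Fin N → ℂ) => betheDen x.1 x.2 i j) (Δ, ξ) := by
    unfold betheDen
    fun_prop
  exact hcont.eventually_ne (h i j hij)

theorem BetheDefined.contDiffAt_betheF (h : BetheDefined Δ ξ) (i : Fin N) {n : WithTop ℕ∞} :
    ContDiffAt ℝ n (fun x : ℝ × (Fin N → ℂ) => betheF L x.1 i x.2) (Δ, ξ) := by
  have hΔ : ContDiffAt ℝ n (fun x : ℝ × (Fin N → ℂ) => (x.1 : ℂ)) (Δ, ξ) :=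
    Complex.ofRealCLM.contDiff.contDiffAt.comp _ contDiffAt_fst
  refine ContDiffAt.add (by fun_prop) (contDiffAt_const.mul (contDiffAt_prod fun j hj => ?_))
  simp only [div_eq_mul_inv]
  exact ContDiffAt.mul (by fun_prop)
    (ContDiffAt.inv (by fun_prop) (h i j (Finset.ne_of_mem_erase hj).symm))

theorem BetheDefined.differentiableAt_betheF (h : BetheDefined Δ ξ) (i : Fin N) :
    DifferentiableAt ℂ (betheF L Δ i) ξ := by
  suffices ContDiffAt ℂ 1 (fun ζ => betheF L Δ i ζ) ξ from this.differentiableAt one_ne_zero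
  refine ContDiffAt.add (by fun_prop) (contDiffAt_const.mul (contDiffAt_prod fun j hj => ?_))
  exact ContDiffAt.div (x := ξ) (by fun_prop) (by fun_prop) (h i j (Finset.ne_of_mem_erase hj).symm)

theorem BetheDefined.betheJ_apply_eq_fderiv_real (h : BetheDefined Δ ξ) (i j : Fin N) :
    betheJ L Δ i ξ j = fderiv ℝ (betheF L Δ i) ξ (Pi.single j 1) := by
  rw [(h.differentiableAt_betheF i).fderiv_restrictScalars ℝ]
  rfl

theorem BetheDefined.contDiffAt_betheJ (h : BetheDefined Δ ξ) (i : Fin N) :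
    ContDiffAt ℝ 1 (fun x : ℝ × (Fin N → ℂ) => betheJ L x.1 i x.2) (Δ, ξ) := by
  refine contDiffAt_pi.2 fun j => ?_
  have hfderiv : ContDiffAt ℝ 1
      (fun x : ℝ × (Fin N → ℂ) => fderiv ℝ (betheF L x.1 i) x.2) (Δ, ξ) :=
    ContDiffAt.fderiv (n := 2) (f := fun x : ℝ × (Fin N → ℂ) => betheF L x.1 i)
      ((h.contDiffAt_betheF i).comp ((Δ, ξ), ξ)
        (f := fun y : (ℝ × (Fin N → ℂ)) × (Fin N → ℂ) => (y.1.1, y.2)) (by fun_prop))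
      contDiffAt_snd (by norm_num)
  refine (hfderiv.clm_apply (contDiffAt_const (c := Pi.single j 1))).congr_of_eventuallyEq ?_
  exact h.eventually.mono fun x hx => hx.betheJ_apply_eq_fderiv_real i j

theorem betheJ_dotProduct (i : Fin N) (v : Fin N → ℂ) :
    betheJ L Δ i ξ ⬝ᵥ v = fderiv ℂ (betheF L Δ i) ξ v := by
  conv_rhs => rw [← Finset.univ_sum_single v, map_sum]
  refine Finset.sum_congr rfl fun j _ => ?_
  have hsingle : Pi.single j (v j) = v j • Pi.single (M := fun _ => ℂ) j 1 := by
    rw [← Pi.single_smul, smul_eq_mul, mul_one]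
  rw [hsingle, map_smul, smul_eq_mul, mul_comm, betheJ]

theorem BetheDefined.fderiv_betheF_inr (h : BetheDefined Δ ξ) (i : Fin N) (v : Fin N → ℂ) :
    fderiv ℝ (fun x : ℝ × (Fin N → ℂ) => betheF L x.1 i x.2) (Δ, ξ) (0, v) =
      betheJ L Δ i ξ ⬝ᵥ v := by
  have hjoint := ((h.contDiffAt_betheF (L := L) i (n := 1)).differentiableAt
    one_ne_zero).hasFDerivAt.comp ξ (hasFDerivAt_prodMk_right (𝕜 := ℝ) Δ ξ)
  have hslice := (h.differentiableAt_betheF (L := L) i).hasFDerivAt.restrictScalars ℝ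
  rw [betheJ_dotProduct]
  exact DFunLike.congr_fun (hjoint.unique hslice) v

theorem exists_hasStrictFDerivAt_kaczmarzStep {i : Fin N} (h : BetheDefined Δ ξ)
    (hF : betheF L Δ i ξ = 0) (hJ : betheJ L Δ i ξ ≠ 0) :
    ∃ D : ℝ × (Fin N → ℂ) →L[ℝ] Fin N → ℂ,
      HasStrictFDerivAt (fun x : ℝ × (Fin N → ℂ) => kaczmarzStep L x.1 i x.2) D (Δ, ξ) ∧
      ∀ v, D (0, v) = v - (betheJ L Δ i ξ ⬝ᵥ v / ((∑ m, ‖betheJ L Δ i ξ m‖ ^ 2 : ℝ) : ℂ)) •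
        star (betheJ L Δ i ξ) := by
  have hcorr := hasStrictFDerivAt_kaczmarz_correction
    ((h.contDiffAt_betheF i).hasStrictFDerivAt one_ne_zero) (h.contDiffAt_betheJ i) hF hJ
  refine ⟨_, hasStrictFDerivAt_snd.sub hcorr, fun v => ?_⟩
  simp only [sub_apply, ContinuousLinearMap.coe_snd',
    ContinuousLinearMap.smulRight_apply, h.fderiv_betheF_inr, smul_smul, div_eq_mul_inv]

end Differentiability

section Sweep

theorem sweep_succ (i : Fin N) :
    sweep L Δ ξ (i + 1) = kaczmarzStep L Δ i (sweep L Δ ξ i) := by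
  simp [sweep]

theorem kaczmarzStep_eq_self {i : Fin N} (h : betheF L Δ i ξ = 0) : kaczmarzStep L Δ i ξ = ξ := by
  funext j
  simp [kaczmarzStep, h]

theorem kaczmarzSeq_eq_iterate (k : Fin N → Fin L) (n : ℕ) :
    kaczmarzSeq L Δ k n = (fun ξ => sweep L Δ ξ N)^[n] (basePoint L k) := by
  induction n with
  | zero => rfl
  | succ n ih => rw [Function.iterate_succ_apply', ← ih, kaczmarzSeq]

/-- The sweep that starts at `ξ` is well defined, and the gradients met along it are linearly
independent; this nondegeneracy makes every fixed point of the sweep a Bethe solution. -/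
def SweepRegular (L : ℕ) (Δ : ℝ) (ξ : Fin N → ℂ) : Prop :=
  (∀ i : Fin N, BetheDefined Δ (sweep L Δ ξ i)) ∧
    LinearIndependent ℂ fun i : Fin N => betheJ L Δ i (sweep L Δ ξ i)

theorem sweep_sub_self (L : ℕ) (Δ : ℝ) (ξ : Fin N → ℂ) :
    sweep L Δ ξ N - ξ = -∑ i : Fin N, (betheF L Δ i (sweep L Δ ξ i) /
      ((∑ m, ‖betheJ L Δ i (sweep L Δ ξ i) m‖ ^ 2 : ℝ) : ℂ)) •
        star (betheJ L Δ i (sweep L Δ ξ i)) := by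
  calc sweep L Δ ξ N - ξ = ∑ i : Fin N, (sweep L Δ ξ (i + 1) - sweep L Δ ξ i) := by
        rw [← Finset.sum_range fun i => sweep L Δ ξ (i + 1) - sweep L Δ ξ i,
          Finset.sum_range_sub, sweep]
    _ = _ := by
        rw [← Finset.sum_neg_distrib]
        refine Finset.sum_congr rfl fun i _ => ?_
        rw [sweep_succ]
        exact sub_sub_cancel_left _ _

theorem SweepRegular.betheF_sweep_eq_zero (hreg : SweepRegular L Δ ξ) (hfix : sweep L Δ ξ N = ξ)
    (i : Fin N) : betheF L Δ i (sweep L Δ ξ i) = 0 := by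
  have hsum := sweep_sub_self L Δ ξ
  rw [hfix, sub_self, zero_eq_neg] at hsum
  have hstar := congrArg star hsum
  simp only [star_sum, star_smul, star_star, star_zero] at hstar
  have hcoeff := star_eq_zero.1 (Fintype.linearIndependent_iff.1 hreg.2 _ hstar i)
  exact (div_eq_zero_iff.1 hcoeff).resolve_right (ofReal_sum_norm_sq_ne_zero (hreg.2.ne_zero i))

theorem sweep_eq_self (h : ∀ i : Fin N, sweep L Δ ξ i = ξ → betheF L Δ i ξ = 0) (m : ℕ) :
    sweep L Δ ξ m = ξ := by
  induction m with
  | zero => rfl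
  | succ m ih =>
    rw [sweep]
    split_ifs with hm
    · rw [ih, kaczmarzStep_eq_self (h ⟨m, hm⟩ ih)]
    · exact ih

theorem betheF_eq_zero_iff (i : Fin N) :
    betheF L Δ i ξ = 0 ↔ ξ i ^ L = (-1) ^ (N - 1) * betheProd Δ i ξ := by
  obtain ⟨n, rfl⟩ : ∃ n, N = n + 1 := Nat.exists_eq_add_one.2 i.pos
  rw [betheF, pow_succ, Nat.add_sub_cancel, mul_neg_one, neg_mul, ← sub_eq_add_neg, sub_eq_zero]

theorem SweepRegular.isBetheSolution (hreg : SweepRegular L Δ ξ) (hfix : sweep L Δ ξ N = ξ) :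
    IsBetheSolution L Δ ξ := by
  have hF := hreg.betheF_sweep_eq_zero hfix
  have hsweep := sweep_eq_self fun i hi => hi ▸ hF i
  simp only [hsweep] at hF
  refine ⟨fun i j hij => ?_, fun i => (betheF_eq_zero_iff i).1 (hF i)⟩
  simpa only [hsweep] using hreg.1 i i j hij

end Sweep

section Decoupled

theorem BetheDefined.betheF_zero (h : BetheDefined 0 ξ) (i : Fin N) :
    betheF L 0 i ξ = ξ i ^ L + (-1) ^ N := by
  rw [betheF, betheProd, Finset.prod_eq_one, mul_one]
  intro j hj
  have hden := h i j (Finset.ne_of_mem_erase hj).symm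
  simp only [betheDen, Complex.ofReal_zero, mul_zero, zero_mul, sub_zero] at hden ⊢
  exact div_self hden

theorem BetheDefined.betheJ_zero (h : BetheDefined 0 ξ) (i : Fin N) :
    betheJ L 0 i ξ = Pi.single i (L * ξ i ^ (L - 1)) := by
  have hpow : betheF L 0 i =ᶠ[𝓝 ξ] fun ζ => ζ i ^ L + (-1) ^ N :=
    ((Continuous.prodMk_right (0 : ℝ)).continuousAt.eventually h.eventually).mono
      fun ζ hζ => hζ.betheF_zero i
  have hderiv : HasFDerivAt (fun ζ : Fin N → ℂ => ζ i ^ L + (-1) ^ N)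
      ((L * ξ i ^ (L - 1)) • (ContinuousLinearMap.proj i : (Fin N → ℂ) →L[ℂ] ℂ)) ξ :=
    ((hasDerivAt_pow L (ξ i)).comp_hasFDerivAt ξ (hasFDerivAt_apply i ξ)).add_const _
  funext j
  rw [betheJ, hpow.fderiv_eq, hderiv.fderiv]
  simp [Pi.single_apply, eq_comm]

/-- A solution of the decoupled equations `ξᵢ ^ L + (-1) ^ N = 0`, to which the Bethe equations
reduce at `Δ = 0`, all of whose entries are simple roots. -/
structure IsDecoupledSolution (L : ℕ) (p : Fin N → ℂ) : Prop where
  betheDefined : BetheDefined 0 p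
  pow_add_eq_zero : ∀ i, p i ^ L + (-1) ^ N = 0
  deriv_ne_zero : ∀ i, (L * p i ^ (L - 1) : ℂ) ≠ 0

namespace IsDecoupledSolution

variable (hp : IsDecoupledSolution L p)
include hp

theorem betheF_eq_zero (i : Fin N) : betheF L 0 i p = 0 := by
  rw [hp.betheDefined.betheF_zero, hp.pow_add_eq_zero]

theorem sweep_eq_self (m : ℕ) : sweep L 0 p m = p :=
  XXZ.sweep_eq_self (fun i _ => hp.betheF_eq_zero i) m

theorem betheJ_ne_zero (i : Fin N) : betheJ L 0 i p ≠ 0 := by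
  rw [hp.betheDefined.betheJ_zero, Ne, Pi.single_eq_zero_iff]
  exact hp.deriv_ne_zero i

-- The gradient is a multiple of the `i`-th basis vector, so the projection along it erases `v i`.
theorem exists_hasStrictFDerivAt_kaczmarzStep (i : Fin N) :
    ∃ D : ℝ × (Fin N → ℂ) →L[ℝ] Fin N → ℂ,
      HasStrictFDerivAt (fun x : ℝ × (Fin N → ℂ) => kaczmarzStep L x.1 i x.2) D (0, p) ∧
      ∀ v, D (0, v) = Function.update v i 0 := by
  obtain ⟨D, hD, hproj⟩ := XXZ.exists_hasStrictFDerivAt_kaczmarzStep hp.betheDefined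
    (hp.betheF_eq_zero i) (hp.betheJ_ne_zero i)
  refine ⟨D, hD, fun v => ?_⟩
  have hsum : ((∑ m, ‖betheJ L 0 i p m‖ ^ 2 : ℝ) : ℂ) =
      L * p i ^ (L - 1) * star (L * p i ^ (L - 1) : ℂ) := by
    rw [hp.betheDefined.betheJ_zero, Finset.sum_eq_single i (by simp +contextual) (by simp),
      Pi.single_eq_same, Complex.star_def, Complex.mul_conj']
    push_cast
    rfl
  have hc := hp.deriv_ne_zero i
  have hc' := star_ne_zero.2 hc
  rw [hproj, hsum, hp.betheDefined.betheJ_zero, single_dotProduct]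
  funext j
  rcases eq_or_ne j i with rfl | hj
  · simp only [Pi.sub_apply, Pi.smul_apply, Pi.star_apply, Pi.single_eq_same, smul_eq_mul,
      Function.update_self]
    rw [mul_div_mul_left _ _ hc, div_mul_cancel₀ _ hc', sub_self]
  · simp [hj]

theorem exists_hasStrictFDerivAt_sweep (m : ℕ) :
    ∃ D : ℝ × (Fin N → ℂ) →L[ℝ] Fin N → ℂ,
      HasStrictFDerivAt (fun x : ℝ × (Fin N → ℂ) => sweep L x.1 x.2 m) D (0, p) ∧
      ∀ v j, D (0, v) j = if (j : ℕ) < m then 0 else v j := by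
  induction m with
  | zero => exact ⟨_, hasStrictFDerivAt_snd, by simp⟩
  | succ m ih =>
    obtain ⟨D, hD, hDv⟩ := ih
    by_cases hm : m < N
    · obtain ⟨S, hS, hSv⟩ := hp.exists_hasStrictFDerivAt_kaczmarzStep ⟨m, hm⟩
      rw [← hp.sweep_eq_self m] at hS
      refine ⟨S.comp ((ContinuousLinearMap.fst ℝ ℝ (Fin N → ℂ)).prod D), ?_, fun v j => ?_⟩
      · simp only [sweep, hm, dif_pos]
        exact hS.comp (f := fun x : ℝ × (Fin N → ℂ) => (x.1, sweep L x.1 x.2 m)) (0, p)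
          (hasStrictFDerivAt_fst.prodMk hD)
      · simp only [ContinuousLinearMap.comp_apply, ContinuousLinearMap.prod_apply,
          ContinuousLinearMap.coe_fst', hSv, Function.update_apply, hDv, Fin.ext_iff]
        grind
    · refine ⟨D, by simpa only [sweep, hm, dif_neg, not_false_eq_true] using hD, fun v j => ?_⟩
      rw [hDv, if_pos (by omega), if_pos (by omega)]

theorem tendsto_prodMk_sweep (m : ℕ) :
    Tendsto (fun x : ℝ × (Fin N → ℂ) => (x.1, sweep L x.1 x.2 m)) (𝓝 (0, p)) (𝓝 (0, p)) := by
  obtain ⟨D, hD, -⟩ := hp.exists_hasStrictFDerivAt_sweep m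
  simpa only [hp.sweep_eq_self] using (continuousAt_fst.prodMk hD.continuousAt).tendsto

theorem eventually_sweepRegular :
    ∀ᶠ x : ℝ × (Fin N → ℂ) in 𝓝 (0, p), SweepRegular L x.1 x.2 := by
  refine (eventually_all.2 fun i : Fin N => (hp.tendsto_prodMk_sweep i).eventually
    hp.betheDefined.eventually).and ?_
  have hJ : Tendsto (fun x : ℝ × (Fin N → ℂ) => fun i : Fin N =>
      betheJ L x.1 i (sweep L x.1 x.2 i)) (𝓝 (0, p)) (𝓝 fun i => betheJ L 0 i p) :=
    tendsto_pi_nhds.2 fun i =>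
      (hp.betheDefined.contDiffAt_betheJ i).continuousAt.tendsto.comp (hp.tendsto_prodMk_sweep i)
  refine hJ.eventually (LinearIndependent.eventually ?_)
  simp only [hp.betheDefined.betheJ_zero]
  exact Pi.linearIndependent_single_of_ne_zero hp.deriv_ne_zero

theorem eventually_tendsto_iterate_sweep {s : Set (Fin N → ℂ)} (hs : s ∈ 𝓝 p) :
    ∀ᶠ Δ : ℝ in 𝓝 0, (∀ n, SweepRegular L Δ ((fun ξ => sweep L Δ ξ N)^[n] p)) ∧
      ∃ ξ ∈ s, IsBetheSolution L Δ ξ ∧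
        Tendsto (fun n => (fun ξ => sweep L Δ ξ N)^[n] p) atTop (𝓝 ξ) := by
  obtain ⟨D, hD, hDv⟩ := hp.exists_hasStrictFDerivAt_sweep N
  have hD_inr : D.comp (.inr ℝ ℝ (Fin N → ℂ)) = 0 := by
    ext v j
    simp [hDv]
  have hev := eventually_tendsto_iterate_of_hasStrictFDerivAt hD (by simp [hD_inr])
    (hp.sweep_eq_self N)
    (hp.eventually_sweepRegular.and (continuousAt_snd.eventually (eventually_mem_set.2 hs)))
  filter_upwards [hev] with Δ ⟨hreg, ξ, ⟨hregξ, hξs⟩, hfix, hlim⟩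
  exact ⟨fun n => (hreg n).1, ξ, hξs, hregξ.isBetheSolution hfix, hlim⟩

end IsDecoupledSolution

theorem isDecoupledSolution_basePoint (k : Fin N → Fin L)
    (hη : ∀ i j, i ≠ j → 1 + rootEta N L (k i) * rootEta N L (k j) ≠ 0) :
    IsDecoupledSolution L (basePoint L k) where
  betheDefined i j hij := by simpa [betheDen, basePoint] using hη i j hij
  pow_add_eq_zero i := rootEta_pow_add_eq_zero (k i)
  deriv_ne_zero i :=
    mul_ne_zero (Nat.cast_ne_zero.2 (k i).pos.ne') (pow_ne_zero _ (rootEta_ne_zero (k i)))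

end Decoupled

end XXZ

theorem lemma4p3_general (N L : ℕ) (k : Fin N → Fin L)
    (hη : ∀ i j, i ≠ j → 1 + XXZ.rootEta N L (k i) * XXZ.rootEta N L (k j) ≠ 0) :
    ∃ ε : ℝ, 0 < ε ∧ ∀ Δ : ℝ, |Δ| < ε →
      (∀ (n : ℕ) (i : Fin N),
        XXZ.BetheDefined Δ (XXZ.sweep L Δ (XXZ.kaczmarzSeq L Δ k n) i) ∧
        XXZ.betheJ L Δ i (XXZ.sweep L Δ (XXZ.kaczmarzSeq L Δ k n) i) ≠ 0) ∧
      ∃ ξ : Fin N → ℂ,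
        Tendsto (XXZ.kaczmarzSeq L Δ k) atTop (𝓝 ξ) ∧
        (∀ i j, k i ≠ k j → ξ i ≠ ξ j) ∧
        XXZ.IsBetheSolution L Δ ξ := by
  have hp := XXZ.isDecoupledSolution_basePoint k hη
  obtain ⟨ε, hε, h⟩ := Metric.eventually_nhds_iff.1
    (hp.eventually_tendsto_iterate_sweep (eventually_forall_apply_ne (XXZ.basePoint L k)))
  refine ⟨ε, hε, fun Δ hΔ => ?_⟩
  obtain ⟨hreg, ξ, hne, hsol, hlim⟩ := h (y := Δ) (by simpa using hΔ)
  simp only [← XXZ.kaczmarzSeq_eq_iterate] at hreg hlim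
  exact ⟨fun n i => ⟨(hreg n).1 i, (hreg n).2.ne_zero i⟩, ξ, hlim,
    fun i j hij => hne i j (XXZ.rootEta_injective.ne hij), hsol⟩

theorem lemma4p3 (N L : ℕ) (k : Fin N → Fin L) (hk : Function.Injective k)
    (hη : ∀ i j, i ≠ j → 1 + XXZ.rootEta N L (k i) * XXZ.rootEta N L (k j) ≠ 0) :
    ∃ ε : ℝ, 0 < ε ∧ ∀ Δ : ℝ, |Δ| < ε →
      -- every step of the recursion is well defined
      (∀ (n : ℕ) (i : Fin N),
        XXZ.BetheDefined Δ (XXZ.sweep L Δ (XXZ.kaczmarzSeq L Δ k n) i) ∧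
        XXZ.betheJ L Δ i (XXZ.sweep L Δ (XXZ.kaczmarzSeq L Δ k n) i) ≠ 0) ∧
      -- the sequence converges to a solution with pairwise distinct entries
      ∃ ξ : Fin N → ℂ,
        Tendsto (XXZ.kaczmarzSeq L Δ k) atTop (𝓝 ξ) ∧
        Function.Injective ξ ∧
        XXZ.IsBetheSolution L Δ ξ := by
  obtain ⟨ε, hε, h⟩ := lemma4p3_general N L k hη
  exact ⟨ε, hε, fun Δ hΔ => (h Δ hΔ).imp_right fun ⟨ξ, hlim, hne, hsol⟩ =>
    ⟨ξ, hlim, fun i j hij => hk (by_contra fun hkij => hne i j hkij hij), hsol⟩⟩
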